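/- Let $a,b,\delta\ge 0$ and let $n_1,n_2$ be measures on $(0,\infty)$ with \[ \int_0^\infty \min\{y^2,y\}\,n_1(dy)+\int_{(0,1)}y\,n_2(dy)+\int_{[1,\infty)}(1+\log y)\,n_2(dy)<\infty . \] For $\lambda\ge 0$ put \[ R(\lambda)=-a\lambda^2-b\lambda-\int_0^\infty\left(e^{-\lambda y}-1+\lambda y\right)n_1(dy),\qquad F(\lambda)=\delta\lambda+\int_0^\infty\left(1-e^{-\lambda y}\right)n_2(dy), \] and assume that neither $R\equiv 0$ nor $F\equiv 0$ on $[0,\infty)$. Consider the continuous state branching process with immigration (CBI-process) on $[0,\infty)$ with generator \[ Lf(x)=axf''(x)-bxf'(x)+x\int_0^\infty\left[f(x+y)-f(x)-yf'(x)\right]n_1(dy)+\delta f'(x)+\int_0^\infty\left[f(x+y)-f(x)\right]n_2(dy), \] that is, the conservative Feller process on $[0,\infty)$ whose generator on $C_0([0,\infty))$ is given by $L$ on the linear hull of the functions $x\mapsto e^{-\lambda x}$, $\lambda>0$. Let $P_t(x,dy)$ be its transition function. **Theorem 2.3.** Suppose that the process has a nondegenerate reversible distribution $\nu$, i.e. a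 probability measure $\nu$ on $[0,\infty)$, not a point mass, such that $\int_A P_t(x,B)\,\nu(dx)=\int_B P_t(x,A)\,\nu(dx)$ for all $t\ge 0$ and all Borel sets $A,B\subseteq[0,\infty)$. Then the process is a CIR model: $n_1=n_2=0$ and $a,b,\delta>0$. Moreover, $\nu$ is the gamma distribution with shape parameter $\delta/a$ and rate parameter $b/a$, i.e. it has density proportional to $x^{\delta/a-1}e^{-bx/a}$ on $(0,\infty)$. -/

import Mathlib

open MeasureTheory ProbabilityTheory Filter Topology Set
open scoped NNReal ENNReal ZeroAtInfty

/-- The characteristics `(a, b, n₁, δ, n₂)` of a CBI-process. The measures `n₁`, `n₂` on `(0, ∞)` are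
represented as measures on `ℝ` giving no mass to `(-∞, 0]`. -/
structure CBIParams where
  a : ℝ
  b : ℝ
  δ : ℝ
  n₁ : Measure ℝ
  n₂ : Measure ℝ
  a_nonneg : 0 ≤ a
  b_nonneg : 0 ≤ b
  δ_nonneg : 0 ≤ δ
  n₁_Iic : n₁ (Iic 0) = 0
  n₂_Iic : n₂ (Iic 0) = 0
  moments :
    (∫⁻ y in Ioi (0 : ℝ), ENNReal.ofReal (min (y ^ 2) y) ∂n₁)
      + (∫⁻ y in Ioo (0 : ℝ) 1, ENNReal.ofReal y ∂n₂)
      + (∫⁻ y in Ici (1 : ℝ), ENNReal.ofReal (1 + Real.log y) ∂n₂) < ∞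

namespace CBIParams

/-- The branching mechanism `R`. -/
noncomputable def R (p : CBIParams) (l : ℝ) : ℝ :=
  -p.a * l ^ 2 - p.b * l - ∫ y in Ioi (0 : ℝ), (Real.exp (-l * y) - 1 + l * y) ∂p.n₁

/-- The immigration mechanism `F`. -/
noncomputable def F (p : CBIParams) (l : ℝ) : ℝ :=
  p.δ * l + ∫ y in Ioi (0 : ℝ), (1 - Real.exp (-l * y)) ∂p.n₂

/-- The integro-differential operator `L`, at a point `x ≥ 0`. Derivatives are taken within the
state space `[0, ∞)`, so that only the values of `f` on `[0, ∞)` matter. -/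
noncomputable def L (p : CBIParams) (f : ℝ → ℝ) (x : ℝ) : ℝ :=
  p.a * x * iteratedDerivWithin 2 f (Ici 0) x
    - p.b * x * derivWithin f (Ici 0) x
    + x * (∫ y in Ioi (0 : ℝ), (f (x + y) - f x - y * derivWithin f (Ici 0) x) ∂p.n₁)
    + p.δ * derivWithin f (Ici 0) x
    + ∫ y in Ioi (0 : ℝ), (f (x + y) - f x) ∂p.n₂

end CBIParams

/-- `P` is the transition function of a conservative Feller process on `[0, ∞)`: a semigroup of
Markov kernels acting on `C₀([0, ∞))` as a strongly continuous semigroup. -/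
structure IsFellerTransitionFunction (P : ℝ≥0 → Kernel ℝ≥0 ℝ≥0) : Prop where
  markov : ∀ t, IsMarkovKernel (P t)
  zero : P 0 = Kernel.id
  semigroup : ∀ s t, P (s + t) = P t ∘ₖ P s
  feller : ∀ (t : ℝ≥0) (f : C₀(ℝ≥0, ℝ)), ∃ g : C₀(ℝ≥0, ℝ), ∀ x, g x = ∫ y, f y ∂(P t x)
  strongly_continuous : ∀ f : C₀(ℝ≥0, ℝ),
    TendstoUniformly (fun (t : ℝ≥0) (x : ℝ≥0) => ∫ y, f y ∂(P t x)) f (𝓝[>] 0)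

/-- `f` lies in the domain of the `C₀`-generator of the semigroup given by `P`, and the generator
maps `f` to `g`: the difference quotients `(T_t f - f) / t` converge to `g` in the supremum norm. -/
def GeneratorMaps (P : ℝ≥0 → Kernel ℝ≥0 ℝ≥0) (f g : C₀(ℝ≥0, ℝ)) : Prop :=
  TendstoUniformly (fun (t : ℝ≥0) (x : ℝ≥0) => ((∫ y, f y ∂(P t x)) - f x) / (t : ℝ)) g (𝓝[>] 0)

/-- `P` is the transition function of the CBI-process with generator `L`: a conservative Feller
process whose generator is given by `L` on the functions `f_l(x) = exp (-l x)`, `l > 0`.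
By linearity the generator is then given by `L` on the linear hull of these functions, which is the
standard core for the generator of a CBI-process, and so the process is determined by `p`. -/
structure IsCBITransitionFunction (p : CBIParams) (P : ℝ≥0 → Kernel ℝ≥0 ℝ≥0) : Prop where
  toFeller : IsFellerTransitionFunction P
  generator : ∀ l : ℝ, 0 < l → ∃ f g : C₀(ℝ≥0, ℝ),
    (∀ x : ℝ≥0, f x = Real.exp (-l * x)) ∧
    (∀ x : ℝ≥0, g x = p.L (fun u => Real.exp (-l * u)) x) ∧
    GeneratorMaps P f g

/-- `ν` is a reversible distribution of the process with transition function `P`: a probability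
measure such that `ν(dx) P_t(x, dy)` is symmetric for every `t`. This implies stationarity. -/
structure IsReversibleDistribution (P : ℝ≥0 → Kernel ℝ≥0 ℝ≥0) (ν : Measure ℝ≥0) : Prop where
  prob : IsProbabilityMeasure ν
  reversible : ∀ t, (P t).IsReversible ν

/-!
On the exponential `exp (-l x)` the generator acts as multiplication by the affine function
`-(x R(l) + F(l))` (`CBIParams.L_exp`). Reversibility makes the semigroup, hence the generator,
symmetric in `L²(ν)` (`integral_mul_generator_comm`). Testing this on two exponentials gives, for
the Laplace transform `H` of `ν` and all `l, m > 0`,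
`(R(l) - R(m)) (-H'(l + m)) = (F(m) - F(l)) H(l + m)` (`IsReversibleDistribution.R_sub_mul_eq`).

The factors `H` and `-H'` at `l + m` depend on the sum only and are positive, as `ν` is not the
point mass at `0`. Combining the relations for `(4, 1)` and `(3, 2)` yields a third difference of
`R`, which annihilates its quadratic part, and one of `F`. They are the integrals of the same
positive function against `n₁` and against `n₂`, while the relation gives them opposite signs. So
both measures vanish (`IsReversibleDistribution.jump_measures_eq_zero`).

Then `R` and `F` are polynomials and the relation becomes the differential equation
`(a s + b) H'(s) = -δ H(s)` with `H(0) = 1` (`laplace_mul_eq_of_hasDerivAt`). For `a = 0` its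
solution belongs to a point mass, for `b = 0` it has none, and for `a, b > 0` the solution is the
Laplace transform of the gamma distribution, which determines the measure (`ext_of_laplace_eq`).
-/

/-! ### The branching and immigration mechanisms -/

namespace CBIParams

lemma integrableOn_min_sq (p : CBIParams) :
    IntegrableOn (fun y : ℝ => min (y ^ 2) y) (Ioi 0) p.n₁ := by
  refine ⟨by fun_prop, ?_⟩
  rw [hasFiniteIntegral_iff_ofReal]
  · exact lt_of_le_of_lt (le_add_right (le_add_right le_rfl)) p.moments
  · filter_upwards [ae_restrict_mem measurableSet_Ioi] with y hy
    exact le_min (sq_nonneg y) (le_of_lt hy)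

lemma integrableOn_id_Ioo (p : CBIParams) : IntegrableOn (fun y : ℝ => y) (Ioo 0 1) p.n₂ := by
  refine ⟨by fun_prop, ?_⟩
  rw [hasFiniteIntegral_iff_ofReal]
  · exact lt_of_le_of_lt (le_add_right (le_add_left le_rfl)) p.moments
  · filter_upwards [ae_restrict_mem measurableSet_Ioo] with y hy using hy.1.le

lemma integrableOn_one_add_log (p : CBIParams) :
    IntegrableOn (fun y : ℝ => 1 + Real.log y) (Ici 1) p.n₂ := by
  refine ⟨by fun_prop, ?_⟩
  rw [hasFiniteIntegral_iff_ofReal]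
  · exact lt_of_le_of_lt (le_add_left le_rfl) p.moments
  · filter_upwards [ae_restrict_mem measurableSet_Ici] with y hy
    have := Real.log_nonneg hy
    simp only [Pi.zero_apply]
    linarith

/-- The integrand of the branching mechanism is integrable, so that the integral defining `R` is
not a junk value. -/
lemma integrableOn_exp_sub_one_add (p : CBIParams) {l : ℝ} (hl : 0 ≤ l) :
    IntegrableOn (fun y : ℝ => Real.exp (-l * y) - 1 + l * y) (Ioi 0) p.n₁ := by
  refine (p.integrableOn_min_sq.const_mul (l ^ 2 + l)).mono' (by fun_prop) ?_
  filter_upwards [ae_restrict_mem measurableSet_Ioi] with y hy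
  have hy : 0 < y := hy
  have hly : 0 ≤ l * y := by positivity
  have h0 : -l * y + 1 ≤ Real.exp (-l * y) := Real.add_one_le_exp _
  have h1 : Real.exp (-l * y) ≤ 1 := Real.exp_le_one_iff.2 (by linarith)
  rw [Real.norm_eq_abs, abs_of_nonneg (by linarith)]
  have h2 : Real.exp (-l * y) - 1 + l * y ≤ (l * y) ^ 2 := by
    rcases le_total (l * y) 1 with h | h
    · have := Real.abs_exp_sub_one_sub_id_le (x := -l * y)
        (by rw [abs_le]; constructor <;> linarith)
      have := (abs_le.1 this).2
      nlinarith
    · nlinarith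
  have h3 : Real.exp (-l * y) - 1 + l * y ≤ l * y := by linarith
  rcases le_total (y ^ 2) y with h | h
  · rw [min_eq_left h]; nlinarith [sq_nonneg y]
  · rw [min_eq_right h]; nlinarith [sq_nonneg l]

/-- The integrand of the immigration mechanism is integrable, so that the integral defining `F` is
not a junk value. -/
lemma integrableOn_one_sub_exp (p : CBIParams) {l : ℝ} (hl : 0 ≤ l) :
    IntegrableOn (fun y : ℝ => 1 - Real.exp (-l * y)) (Ioi 0) p.n₂ := by
  have hbound : ∀ y : ℝ, 0 ≤ y → 0 ≤ 1 - Real.exp (-l * y) ∧ 1 - Real.exp (-l * y) ≤ l * y ∧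
      1 - Real.exp (-l * y) ≤ 1 := fun y hy => by
    have hly : 0 ≤ l * y := by positivity
    have h0 : -l * y + 1 ≤ Real.exp (-l * y) := Real.add_one_le_exp _
    have h1 : Real.exp (-l * y) ≤ 1 := Real.exp_le_one_iff.2 (by linarith)
    exact ⟨by linarith, by linarith, by linarith [Real.exp_pos (-l * y)]⟩
  rw [← Ioo_union_Ici_eq_Ioi (zero_lt_one' ℝ)]
  refine IntegrableOn.union ?_ ?_
  · refine (p.integrableOn_id_Ioo.const_mul l).mono' (by fun_prop) ?_
    filter_upwards [ae_restrict_mem measurableSet_Ioo] with y hy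
    obtain ⟨h0, h1, -⟩ := hbound y hy.1.le
    rwa [Real.norm_eq_abs, abs_of_nonneg h0]
  · refine p.integrableOn_one_add_log.mono' (by fun_prop) ?_
    filter_upwards [ae_restrict_mem measurableSet_Ici] with y hy
    have hy : 1 ≤ y := hy
    obtain ⟨h0, -, h1⟩ := hbound y (by linarith)
    rw [Real.norm_eq_abs, abs_of_nonneg h0]
    linarith [Real.log_nonneg hy]

/-- On exponentials the generator acts by multiplication with an affine function. -/
lemma L_exp (p : CBIParams) (l : ℝ) {x : ℝ} (hx : 0 ≤ x) :
    p.L (fun u => Real.exp (-l * u)) x = Real.exp (-l * x) * (-(x * p.R l) - p.F l) := by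
  have hd : ∀ u ∈ Ici (0 : ℝ),
      derivWithin (fun u => Real.exp (-l * u)) (Ici 0) u = -l * Real.exp (-l * u) := fun u hu => by
    have : HasDerivAt (fun u => Real.exp (-l * u)) (Real.exp (-l * u) * (-l * 1)) u :=
      ((hasDerivAt_id u).const_mul (-l)).exp
    rw [this.hasDerivWithinAt.derivWithin (uniqueDiffOn_Ici 0 u hu)]
    ring
  have hdd : iteratedDerivWithin 2 (fun u => Real.exp (-l * u)) (Ici 0) x
      = l ^ 2 * Real.exp (-l * x) := by
    have : HasDerivAt (fun u => -l * Real.exp (-l * u)) (-l * (Real.exp (-l * x) * (-l * 1))) x :=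
      (((hasDerivAt_id x).const_mul (-l)).exp).const_mul (-l)
    rw [iteratedDerivWithin_succ, iteratedDerivWithin_one, derivWithin_congr hd (hd x hx),
      this.hasDerivWithinAt.derivWithin (uniqueDiffOn_Ici 0 x hx)]
    ring
  have h1 : ∀ y : ℝ, Real.exp (-l * (x + y)) - Real.exp (-l * x) - y * (-l * Real.exp (-l * x))
      = Real.exp (-l * x) * (Real.exp (-l * y) - 1 + l * y) := fun y => by
    rw [mul_add, Real.exp_add]; ring
  have h2 : ∀ y : ℝ, Real.exp (-l * (x + y)) - Real.exp (-l * x)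
      = -Real.exp (-l * x) * (1 - Real.exp (-l * y)) := fun y => by
    rw [mul_add, Real.exp_add]; ring
  simp only [L, hdd, hd x hx, h1]
  simp only [R, F, h2, integral_const_mul]
  ring

/-- The negative of the third difference of `l ↦ exp (-l y)` at `1, 2, 3, 4`. -/
noncomputable def thirdDiff (y : ℝ) : ℝ := Real.exp (-y) * (1 - Real.exp (-y)) ^ 3

lemma thirdDiff_pos {y : ℝ} (hy : 0 < y) : 0 < thirdDiff y := by
  have : Real.exp (-y) < 1 := Real.exp_lt_one_iff.2 (by linarith)
  exact mul_pos (Real.exp_pos _) (pow_pos (by linarith) 3)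

lemma thirdDiff_eq (y : ℝ) : thirdDiff y = -Real.exp (-4 * y) + 3 * Real.exp (-3 * y)
    - 3 * Real.exp (-2 * y) + Real.exp (-1 * y) := by
  have h2 : Real.exp (-2 * y) = Real.exp (-y) ^ 2 := by rw [← Real.exp_nat_mul]; ring_nf
  have h3 : Real.exp (-3 * y) = Real.exp (-y) ^ 3 := by rw [← Real.exp_nat_mul]; ring_nf
  have h4 : Real.exp (-4 * y) = Real.exp (-y) ^ 4 := by rw [← Real.exp_nat_mul]; ring_nf
  rw [thirdDiff, h2, h3, h4, neg_one_mul]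
  ring

/-- The third difference annihilates the quadratic part of `R`. -/
lemma thirdDiff_R (p : CBIParams) : IntegrableOn thirdDiff (Ioi 0) p.n₁ ∧
    (p.R 4 - p.R 1) - 3 * (p.R 3 - p.R 2) = ∫ y in Ioi 0, thirdDiff y ∂p.n₁ := by
  have i1 := p.integrableOn_exp_sub_one_add (zero_le_one' ℝ)
  have i2 := p.integrableOn_exp_sub_one_add (zero_le_two (α := ℝ))
  have i3 := p.integrableOn_exp_sub_one_add (zero_le_three (α := ℝ))
  have i4 := p.integrableOn_exp_sub_one_add (zero_le_four (α := ℝ))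
  have heq : thirdDiff = fun y : ℝ => (Real.exp (-1 * y) - 1 + 1 * y)
      - (Real.exp (-4 * y) - 1 + 4 * y)
      + 3 * ((Real.exp (-3 * y) - 1 + 3 * y) - (Real.exp (-2 * y) - 1 + 2 * y)) := by
    funext y; rw [thirdDiff_eq]; ring
  rw [heq]
  refine ⟨(i1.sub i4).add ((i3.sub i2).const_mul 3), ?_⟩
  have h : ∫ y in Ioi 0, ((Real.exp (-1 * y) - 1 + 1 * y) - (Real.exp (-4 * y) - 1 + 4 * y)
      + 3 * ((Real.exp (-3 * y) - 1 + 3 * y) - (Real.exp (-2 * y) - 1 + 2 * y))) ∂p.n₁ = _ :=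
    integral_add (i1.sub i4) ((i3.sub i2).const_mul 3)
  rw [h, integral_const_mul, integral_sub i1 i4, integral_sub i3 i2]
  simp only [R]
  ring

lemma thirdDiff_F (p : CBIParams) : IntegrableOn thirdDiff (Ioi 0) p.n₂ ∧
    (p.F 4 - p.F 1) - 3 * (p.F 3 - p.F 2) = ∫ y in Ioi 0, thirdDiff y ∂p.n₂ := by
  have i1 := p.integrableOn_one_sub_exp (zero_le_one' ℝ)
  have i2 := p.integrableOn_one_sub_exp (zero_le_two (α := ℝ))
  have i3 := p.integrableOn_one_sub_exp (zero_le_three (α := ℝ))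
  have i4 := p.integrableOn_one_sub_exp (zero_le_four (α := ℝ))
  have heq : thirdDiff = fun y : ℝ => (1 - Real.exp (-4 * y)) - (1 - Real.exp (-1 * y))
      - 3 * ((1 - Real.exp (-3 * y)) - (1 - Real.exp (-2 * y))) := by
    funext y; rw [thirdDiff_eq]; ring
  rw [heq]
  refine ⟨(i4.sub i1).sub ((i3.sub i2).const_mul 3), ?_⟩
  have h : ∫ y in Ioi 0, ((1 - Real.exp (-4 * y)) - (1 - Real.exp (-1 * y))
      - 3 * ((1 - Real.exp (-3 * y)) - (1 - Real.exp (-2 * y)))) ∂p.n₂ = _ :=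
    integral_sub (i4.sub i1) ((i3.sub i2).const_mul 3)
  rw [h, integral_const_mul, integral_sub i4 i1, integral_sub i3 i2]
  simp only [F]
  ring

end CBIParams

lemma MeasureTheory.Measure.eq_zero_of_setIntegral_eq_zero {μ : Measure ℝ} (hμ : μ (Iic 0) = 0)
    {f : ℝ → ℝ} (hf : ∀ y, 0 < y → 0 < f y) (hfi : IntegrableOn f (Ioi 0) μ)
    (h : ∫ y in Ioi 0, f y ∂μ = 0) : μ = 0 := by
  have hnn : 0 ≤ᵐ[μ.restrict (Ioi 0)] f := by
    filter_upwards [ae_restrict_mem measurableSet_Ioi] with y hy using (hf y hy).le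
  have h0 : ∀ᵐ y ∂μ.restrict (Ioi 0), False := by
    filter_upwards [ae_restrict_mem measurableSet_Ioi,
      (integral_eq_zero_iff_of_nonneg_ae hnn hfi).1 h] with y hy h0 using (hf y hy).ne' h0
  have hI : μ (Ioi 0) = 0 := by
    rwa [eventually_false_iff_eq_bot, ae_eq_bot, Measure.restrict_eq_zero] at h0
  rw [← measure_univ_eq_zero, ← Iic_union_Ioi (a := (0 : ℝ))]
  exact measure_union_null hμ hI

/-! ### Laplace transforms on the half-line -/

/-- The Laplace transform `∫ exp (-s x) ν(dx)` of a measure on `[0, ∞)`. -/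
noncomputable def laplace (ν : Measure ℝ≥0) (s : ℝ) : ℝ := ∫ x : ℝ≥0, Real.exp (-s * x) ∂ν

lemma integrable_exp_neg_mul (ν : Measure ℝ≥0) [IsFiniteMeasure ν] {s : ℝ} (hs : 0 ≤ s) :
    Integrable (fun x : ℝ≥0 => Real.exp (-s * x)) ν := by
  refine Integrable.of_bound (by fun_prop) 1 (ae_of_all _ fun x => ?_)
  rw [Real.norm_eq_abs, abs_of_pos (Real.exp_pos _), Real.exp_le_one_iff]
  have := mul_nonneg hs x.2
  simp only [NNReal.val_eq_coe] at this
  linarith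

lemma mem_interior_integrableExpSet (ν : Measure ℝ≥0) [IsFiniteMeasure ν] {s : ℝ} (hs : 0 < s) :
    -s ∈ interior (integrableExpSet (fun x : ℝ≥0 => (x : ℝ)) ν) := by
  rw [mem_interior]
  refine ⟨Iio 0, fun t ht => ?_, isOpen_Iio, by simpa using hs⟩
  have := integrable_exp_neg_mul ν (s := -t) (by simpa using le_of_lt ht)
  simpa [integrableExpSet] using this

lemma integrable_mul_exp_neg_mul (ν : Measure ℝ≥0) [IsFiniteMeasure ν] {s : ℝ} (hs : 0 < s) :
    Integrable (fun x : ℝ≥0 => (x : ℝ) * Real.exp (-s * x)) ν := by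
  simpa using integrable_pow_mul_exp_of_mem_interior_integrableExpSet
    (mem_interior_integrableExpSet ν hs) 1

lemma hasDerivAt_laplace (ν : Measure ℝ≥0) [IsFiniteMeasure ν] {s : ℝ} (hs : 0 < s) :
    HasDerivAt (laplace ν) (-∫ x : ℝ≥0, (x : ℝ) * Real.exp (-s * x) ∂ν) s := by
  have h := (hasDerivAt_mgf (mem_interior_integrableExpSet ν hs)).comp s (hasDerivAt_neg s)
  rw [mul_neg_one] at h
  exact h

lemma laplace_zero (ν : Measure ℝ≥0) [IsProbabilityMeasure ν] : laplace ν 0 = 1 := by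
  simp [laplace]

lemma laplace_pos (ν : Measure ℝ≥0) [IsProbabilityMeasure ν] {s : ℝ} (hs : 0 ≤ s) :
    0 < laplace ν s := integral_exp_pos (integrable_exp_neg_mul ν hs)

lemma continuousOn_laplace (ν : Measure ℝ≥0) [IsFiniteMeasure ν] :
    ContinuousOn (laplace ν) (Ici 0) := by
  refine continuousOn_of_dominated (bound := fun _ => 1) (fun s _ => by fun_prop) (fun s hs => ?_)
    (integrable_const _) (ae_of_all _ fun x => by fun_prop)
  refine ae_of_all _ fun x => ?_
  rw [Real.norm_eq_abs, abs_of_pos (Real.exp_pos _), Real.exp_le_one_iff]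
  have := mul_nonneg hs x.2
  simp only [NNReal.val_eq_coe] at this
  linarith

/-- A finite measure on `[0, ∞)` is determined by the values of its Laplace transform at the natural
numbers: the polynomials in `exp (-x)` form a point-separating algebra of bounded functions. -/
lemma ext_of_laplace_eq {ν ρ : Measure ℝ≥0} [IsFiniteMeasure ν] [IsFiniteMeasure ρ]
    (h : ∀ n : ℕ, laplace ν n = laplace ρ n) : ν = ρ := by
  let e : BoundedContinuousFunction ℝ≥0 ℝ :=
    BoundedContinuousFunction.ofNormedAddCommGroup (fun x : ℝ≥0 => Real.exp (-(x : ℝ)))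
      (by fun_prop) 1 (fun x => by
        rw [Real.norm_eq_abs, abs_of_pos (Real.exp_pos _), Real.exp_le_one_iff]
        simp)
  have he : ∀ x, e x = Real.exp (-(x : ℝ)) := fun x => rfl
  let A : StarSubalgebra ℝ (BoundedContinuousFunction ℝ≥0 ℝ) :=
    { Algebra.adjoin ℝ {e} with
      star_mem' := fun {a} ha => by
        rwa [show star a = a from BoundedContinuousFunction.ext fun x => star_trivial (a x)] }
  have hA : ∀ g, g ∈ A ↔ g ∈ Algebra.adjoin ℝ {e} := fun g => Iff.rfl
  refine ext_of_forall_mem_subalgebra_integral_eq_of_pseudoEMetric_complete_countable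
    (A := A) ?_ ?_
  · intro x y hxy
    refine ⟨e, ?_, ?_⟩
    · refine ⟨BoundedContinuousFunction.toContinuousMapStarₐ ℝ e, ?_, rfl⟩
      exact ⟨e, Algebra.subset_adjoin rfl, rfl⟩
    · rw [he, he]
      simpa using hxy
  · intro g hg
    rw [hA, Algebra.adjoin_singleton_eq_range_aeval] at hg
    obtain ⟨q, rfl⟩ := hg
    induction q using Polynomial.induction_on' with
    | add q r hq hr =>
      simp only [AlgHom.toRingHom_eq_coe, RingHom.coe_coe, map_add,
        BoundedContinuousFunction.coe_add, Pi.add_apply] at hq hr ⊢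
      rw [integral_add (BoundedContinuousFunction.integrable _ _)
        (BoundedContinuousFunction.integrable _ _),
        integral_add (BoundedContinuousFunction.integrable _ _)
        (BoundedContinuousFunction.integrable _ _), hq, hr]
    | monomial n c =>
      have : ∀ x, (Polynomial.aeval e (Polynomial.monomial n c)) x
          = c * Real.exp (-(n : ℝ) * (x : ℝ)) := fun x => by
        rw [Polynomial.aeval_monomial, Algebra.algebraMap_eq_smul_one, smul_one_mul]
        simp only [BoundedContinuousFunction.coe_smul, BoundedContinuousFunction.coe_pow,
          Pi.pow_apply, he, smul_eq_mul, ← Real.exp_nat_mul, mul_neg, neg_mul]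
      simp only [AlgHom.toRingHom_eq_coe, RingHom.coe_coe, this, integral_const_mul]
      exact congrArg (c * ·) (h n)

/-- The differential equation `H' = -(g' / g) H` for a Laplace transform integrates to
`H g = const` up to the boundary point `0`. -/
lemma laplace_mul_eq_of_hasDerivAt (ν : Measure ℝ≥0) [IsProbabilityMeasure ν] {g c : ℝ → ℝ}
    (hg : ContinuousOn g (Ici 0)) (hg' : ∀ s, 0 < s → HasDerivAt g (c s * g s) s)
    (h : ∀ s, 0 < s → ∫ x : ℝ≥0, (x : ℝ) * Real.exp (-s * x) ∂ν = c s * laplace ν s)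
    {s : ℝ} (hs : 0 ≤ s) : laplace ν s * g s = g 0 := by
  rcases hs.eq_or_lt with rfl | hs
  · rw [laplace_zero, one_mul]
  obtain ⟨t, ht, hst⟩ := exists_hasDerivAt_eq_slope (fun s => laplace ν s * g s) (fun _ => 0) hs
    (((continuousOn_laplace ν).mul hg).mono Icc_subset_Ici_self) (fun t ht => by
      have := (hasDerivAt_laplace ν ht.1).mul (hg' t ht.1)
      rw [h t ht.1] at this
      exact this.congr_deriv (by ring))
  rw [laplace_zero, one_mul, eq_comm, div_eq_zero_iff] at hst
  rcases hst with hst | hst <;> linarith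

lemma laplace_dirac (x : ℝ≥0) (s : ℝ) : laplace (Measure.dirac x) s = Real.exp (-s * x) := by
  simp [laplace]

/-- The first moment of the exponentially tilted measure is positive unless all mass sits at `0`. -/
lemma integral_mul_exp_neg_mul_pos (ν : Measure ℝ≥0) [IsProbabilityMeasure ν]
    (hν : ν ≠ Measure.dirac 0) {s : ℝ} (hs : 0 < s) :
    0 < ∫ x : ℝ≥0, (x : ℝ) * Real.exp (-s * x) ∂ν := by
  have hnn : 0 ≤ fun x : ℝ≥0 => (x : ℝ) * Real.exp (-s * x) := fun x => by
    simp only [Pi.zero_apply]; positivity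
  refine (integral_nonneg hnn).lt_of_ne' fun h0 => hν ?_
  have h := (integral_eq_zero_iff_of_nonneg hnn (integrable_mul_exp_neg_mul ν hs)).1 h0
  refine ext_of_laplace_eq fun n => ?_
  rw [laplace_dirac]
  have : ∀ᵐ x : ℝ≥0 ∂ν, Real.exp (-(n : ℝ) * (x : ℝ)) = 1 := by
    filter_upwards [h] with x hx
    have : (x : ℝ) = 0 := by simpa [Real.exp_ne_zero] using hx
    simp [this]
  rw [laplace, integral_congr_ae this]
  simp

lemma integral_gammaMeasure_exp {k r : ℝ} (hk : 0 < k) (hr : 0 < r) {s : ℝ} (hs : 0 ≤ s) :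
    ∫ x, Real.exp (-s * x) ∂(gammaMeasure k r) = (r / (r + s)) ^ k := by
  have hrs : 0 < r + s := by linarith
  have hm : Measurable (gammaPDF k r) := (measurable_gammaPDFReal k r).ennreal_ofReal
  rw [gammaMeasure, integral_withDensity_eq_integral_toReal_smul hm (by simp [gammaPDF])]
  have h0 : ∀ x, (gammaPDF k r x).toReal = gammaPDFReal k r x := fun x =>
    ENNReal.toReal_ofReal (gammaPDFReal_nonneg hk hr x)
  simp only [h0, smul_eq_mul]
  have h1 : (fun x => gammaPDFReal k r x * Real.exp (-s * x)) = (Ici 0).indicator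
      (fun x => r ^ k / Real.Gamma k * (x ^ (k - 1) * Real.exp (-((r + s) * x)))) := by
    funext x
    rw [gammaPDFReal, indicator_apply]
    simp only [mem_Ici]
    split_ifs with h
    · rw [mul_assoc, mul_assoc, ← Real.exp_add]; ring_nf
    · rw [zero_mul]
  rw [h1, integral_indicator measurableSet_Ici, integral_Ici_eq_integral_Ioi, integral_const_mul,
    Real.integral_rpow_mul_exp_neg_mul_Ioi hk hrs, Real.div_rpow hr.le hrs.le,
    Real.div_rpow zero_le_one hrs.le, Real.one_rpow]
  have := (Real.Gamma_pos_of_pos hk).ne'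
  field_simp

/-- A probability measure on `[0, ∞)` with the Laplace transform of a gamma distribution is that
gamma distribution. -/
lemma map_coe_eq_gammaMeasure (ν : Measure ℝ≥0) [IsFiniteMeasure ν] {k r : ℝ} (hk : 0 < k)
    (hr : 0 < r) (h : ∀ s, 0 ≤ s → laplace ν s = (r / (r + s)) ^ k) :
    ν.map (fun x : ℝ≥0 => (x : ℝ)) = gammaMeasure k r := by
  have := isProbabilityMeasure_gammaMeasure hk hr
  have hpos : ∀ᵐ x ∂(gammaMeasure k r), 0 ≤ x := by
    have hm : Measurable (gammaPDF k r) := (measurable_gammaPDFReal k r).ennreal_ofReal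
    rw [gammaMeasure, ae_withDensity_iff hm]
    exact ae_of_all _ fun x hx => not_lt.1 fun hx0 => hx (gammaPDF_of_neg hx0)
  have hνγ : ν = (gammaMeasure k r).map Real.toNNReal := by
    have := Measure.isProbabilityMeasure_map (μ := gammaMeasure k r)
      (measurable_real_toNNReal.aemeasurable)
    refine ext_of_laplace_eq fun n => ?_
    rw [h n n.cast_nonneg, ← integral_gammaMeasure_exp hk hr n.cast_nonneg, laplace,
      integral_map measurable_real_toNNReal.aemeasurable (by fun_prop)]
    refine integral_congr_ae ?_
    filter_upwards [hpos] with x hx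
    rw [Real.coe_toNNReal x hx]
  rw [hνγ, Measure.map_map (by fun_prop) measurable_real_toNNReal]
  conv_rhs => rw [← Measure.map_id (μ := gammaMeasure k r)]
  refine Measure.map_congr ?_
  filter_upwards [hpos] with x hx
  simp [hx]

/-! ### Reversibility and the generator -/

/-- Reversibility says that the joint law `π(dx) κ(x, dy)` is symmetric. -/
lemma ProbabilityTheory.Kernel.IsReversible.map_swap_compProd {α : Type*} [MeasurableSpace α]
    {κ : Kernel α α} [IsMarkovKernel κ] {π : Measure α} [IsFiniteMeasure π]
    (h : κ.IsReversible π) : (π ⊗ₘ κ).map Prod.swap = π ⊗ₘ κ := by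
  refine Measure.ext_prod fun {s t} hs ht => ?_
  rw [Measure.map_apply measurable_swap (hs.prod ht), preimage_swap_prod,
    Measure.compProd_apply_prod ht hs, Measure.compProd_apply_prod hs ht, h ht hs]

lemma ProbabilityTheory.Kernel.IsReversible.integral_mul_comm {α : Type*} [MeasurableSpace α]
    {κ : Kernel α α} [IsMarkovKernel κ] {π : Measure α} [IsFiniteMeasure π]
    (h : κ.IsReversible π) {f g : α → ℝ} (hf : Measurable f) (hg : Measurable g)
    {C D : ℝ} (hC : ∀ x, |f x| ≤ C) (hD : ∀ x, |g x| ≤ D) :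
    ∫ x, f x * ∫ y, g y ∂(κ x) ∂π = ∫ x, g x * ∫ y, f y ∂(κ x) ∂π := by
  have hint : ∀ {f g : α → ℝ}, Measurable f → Measurable g → ∀ {C D : ℝ}, (∀ x, |f x| ≤ C) →
      (∀ x, |g x| ≤ D) → ∫ x, f x * ∫ y, g y ∂(κ x) ∂π = ∫ z, f z.1 * g z.2 ∂(π ⊗ₘ κ) := by
    intro f g hf hg C D hC hD
    rw [Measure.integral_compProd]
    · simp only [integral_const_mul]
    · refine Integrable.of_bound (by fun_prop) (C * D) (ae_of_all _ fun z => ?_)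
      rw [Real.norm_eq_abs, abs_mul]
      exact mul_le_mul (hC _) (hD _) (abs_nonneg _) ((abs_nonneg _).trans (hC z.1))
  rw [hint hf hg hC hD, hint hg hf hD hC, ← h.map_swap_compProd,
    integral_map measurable_swap.aemeasurable (by fun_prop), h.map_swap_compProd]
  simp only [Prod.fst_swap, Prod.snd_swap, mul_comm]

/-- Uniform convergence of bounded functions passes to integrals against a bounded function. -/
lemma tendsto_integral_mul_of_tendstoUniformly {ν : Measure ℝ≥0} [IsFiniteMeasure ν]
    {u : ℝ≥0 → ℝ≥0 → ℝ} {f g : C₀(ℝ≥0, ℝ)} {l : Filter ℝ≥0} [l.IsCountablyGenerated]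
    (hu : ∀ t, StronglyMeasurable (u t)) (h : TendstoUniformly u g l) :
    Tendsto (fun t => ∫ x, f x * u t x ∂ν) l (𝓝 (∫ x, f x * g x ∂ν)) := by
  refine tendsto_integral_filter_of_dominated_convergence (fun _ => ‖f‖ * (‖g‖ + 1))
    (Eventually.of_forall fun t => ?_) ?_ (integrable_const _) (ae_of_all _ fun x => ?_)
  · exact (f.continuous.stronglyMeasurable.mul (hu t)).aestronglyMeasurable
  · filter_upwards [Metric.tendstoUniformly_iff.1 h 1 one_pos] with t ht
    refine ae_of_all _ fun x => ?_
    rw [norm_mul]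
    refine mul_le_mul (f.toBCF.norm_coe_le_norm x) ?_ (norm_nonneg _) (norm_nonneg _)
    have h1 := ht x
    have h2 : ‖g x‖ ≤ ‖g‖ := g.toBCF.norm_coe_le_norm x
    rw [dist_comm, dist_eq_norm] at h1
    calc ‖u t x‖ = ‖(u t x - g x) + g x‖ := by rw [sub_add_cancel]
      _ ≤ ‖u t x - g x‖ + ‖g x‖ := norm_add_le _ _
      _ ≤ ‖g‖ + 1 := by linarith
  · exact (h.tendsto_at x).const_mul (f x)

/-- The generator of a reversible process is symmetric in `L²(ν)`. -/
lemma integral_mul_generator_comm {P : ℝ≥0 → Kernel ℝ≥0 ℝ≥0} {ν : Measure ℝ≥0}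
    (hP : IsFellerTransitionFunction P) (hν : IsReversibleDistribution P ν)
    {f₁ g₁ f₂ g₂ : C₀(ℝ≥0, ℝ)} (h₁ : GeneratorMaps P f₁ g₁) (h₂ : GeneratorMaps P f₂ g₂) :
    ∫ x, f₁ x * g₂ x ∂ν = ∫ x, f₂ x * g₁ x ∂ν := by
  have := hν.prob
  have hmarkov := hP.markov
  have hbdd : ∀ (f : C₀(ℝ≥0, ℝ)) x, |f x| ≤ ‖f‖ := fun f x => f.toBCF.norm_coe_le_norm x
  have hsm : ∀ (f : C₀(ℝ≥0, ℝ)) (t : ℝ≥0), StronglyMeasurable fun x => ∫ y, f y ∂(P t x) :=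
    fun f t => f.continuous.stronglyMeasurable.integral_kernel
  have hquot : ∀ (f : C₀(ℝ≥0, ℝ)) (t : ℝ≥0),
      StronglyMeasurable fun x => ((∫ y, f y ∂(P t x)) - f x) / (t : ℝ) := fun f t =>
    
    (((hsm f t).measurable.sub f.continuous.measurable).div_const _).stronglyMeasurable
  have hint : ∀ (f g : C₀(ℝ≥0, ℝ)), Integrable (fun x => f x * g x) ν := fun f g => by
    refine Integrable.of_bound (by fun_prop) (‖f‖ * ‖g‖) (ae_of_all _ fun x => ?_)
    rw [norm_mul]
    exact mul_le_mul (hbdd f x) (hbdd g x) (norm_nonneg _) (norm_nonneg _)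
  have hintP : ∀ (f g : C₀(ℝ≥0, ℝ)) (t : ℝ≥0),
      Integrable (fun x => f x * ∫ y, g y ∂(P t x)) ν := fun f g t => by
    obtain ⟨k, hk⟩ := hP.feller t g
    simpa only [hk] using hint f k
  have hsplit : ∀ (f g : C₀(ℝ≥0, ℝ)) (t : ℝ≥0),
      ∫ x, f x * (((∫ y, g y ∂(P t x)) - g x) / (t : ℝ)) ∂ν
        = ((∫ x, f x * ∫ y, g y ∂(P t x) ∂ν) - ∫ x, f x * g x ∂ν) / t := fun f g t => by
    rw [← integral_sub (hintP f g t) (hint f g), ← integral_div]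
    refine integral_congr_ae (ae_of_all _ fun x => ?_)
    ring
  refine tendsto_nhds_unique
    (tendsto_integral_mul_of_tendstoUniformly (ν := ν) (f := f₁) (hquot f₂) h₂) ?_
  refine (tendsto_integral_mul_of_tendstoUniformly (ν := ν) (f := f₂) (hquot f₁) h₁).congr
    fun t => ?_
  rw [hsplit, hsplit, (hν.reversible t).integral_mul_comm (f := f₁) (g := f₂)
    f₁.continuous.measurable f₂.continuous.measurable (hbdd f₁) (hbdd f₂)]
  simp only [mul_comm]

/-- The symmetry of the generator, tested on the exponentials `exp (-l x)` and `exp (-m x)`. -/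
lemma IsReversibleDistribution.R_sub_mul_eq {p : CBIParams} {P : ℝ≥0 → Kernel ℝ≥0 ℝ≥0}
    {ν : Measure ℝ≥0} (hP : IsCBITransitionFunction p P) (hν : IsReversibleDistribution P ν)
    {l m : ℝ} (hl : 0 < l) (hm : 0 < m) :
    (p.R l - p.R m) * ∫ x : ℝ≥0, (x : ℝ) * Real.exp (-(l + m) * x) ∂ν
      = (p.F m - p.F l) * laplace ν (l + m) := by
  have := hν.prob
  have hlm : 0 < l + m := add_pos hl hm
  obtain ⟨f₁, g₁, hf₁, hg₁, h₁⟩ := hP.generator l hl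
  obtain ⟨f₂, g₂, hf₂, hg₂, h₂⟩ := hP.generator m hm
  have key := integral_mul_generator_comm hP.toFeller hν h₁ h₂
  have hexp : ∀ c d : ℝ, ∫ x : ℝ≥0, (c * ((x : ℝ) * Real.exp (-(l + m) * x))
      + d * Real.exp (-(l + m) * x)) ∂ν
      = c * (∫ x : ℝ≥0, (x : ℝ) * Real.exp (-(l + m) * x) ∂ν) + d * laplace ν (l + m) :=
    fun c d => by
    rw [integral_add ((integrable_mul_exp_neg_mul ν hlm).const_mul c)
      ((integrable_exp_neg_mul ν hlm.le).const_mul d), integral_const_mul, integral_const_mul,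
      laplace]
  have e1 : ∀ x : ℝ≥0, f₁ x * g₂ x = -p.R m * ((x : ℝ) * Real.exp (-(l + m) * x))
      + -p.F m * Real.exp (-(l + m) * x) := fun x => by
    rw [hf₁, hg₂, p.L_exp m x.coe_nonneg, neg_add, add_mul, Real.exp_add]
    ring
  have e2 : ∀ x : ℝ≥0, f₂ x * g₁ x = -p.R l * ((x : ℝ) * Real.exp (-(l + m) * x))
      + -p.F l * Real.exp (-(l + m) * x) := fun x => by
    rw [hf₂, hg₁, p.L_exp l x.coe_nonneg, neg_add, add_mul, Real.exp_add]
    ring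
  simp only [e1, e2, hexp] at key
  linarith

/-! ### The jump measures vanish -/

/-- In the symmetric relation at `l + m = 5`, the third difference of `R` over `1, 2, 3, 4` is the
integral of a positive function against `n₁`, that of `F` the integral of the same function against
`n₂`, and the relation gives them opposite signs. -/
lemma IsReversibleDistribution.jump_measures_eq_zero {p : CBIParams}
    {P : ℝ≥0 → Kernel ℝ≥0 ℝ≥0} {ν : Measure ℝ≥0} (hP : IsCBITransitionFunction p P)
    (hν : IsReversibleDistribution P ν) (hν0 : ν ≠ Measure.dirac 0) : p.n₁ = 0 ∧ p.n₂ = 0 := by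
  have := hν.prob
  have hG := integral_mul_exp_neg_mul_pos ν hν0 (s := 5) (by norm_num)
  have hH := laplace_pos ν (s := 5) (by norm_num)
  have h41 := hν.R_sub_mul_eq hP (l := 4) (m := 1) (by norm_num) (by norm_num)
  have h32 := hν.R_sub_mul_eq hP (l := 3) (m := 2) (by norm_num) (by norm_num)
  rw [show (4 + 1 : ℝ) = 5 by norm_num] at h41
  rw [show (3 + 2 : ℝ) = 5 by norm_num] at h32
  obtain ⟨i1, h1⟩ := p.thirdDiff_R
  obtain ⟨i2, h2⟩ := p.thirdDiff_F
  have hnn : ∀ μ : Measure ℝ, 0 ≤ ∫ y in Ioi 0, CBIParams.thirdDiff y ∂μ := fun μ =>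
    setIntegral_nonneg measurableSet_Ioi fun y hy => (CBIParams.thirdDiff_pos hy).le
  have hn1 := hnn p.n₁
  have hn2 := hnn p.n₂
  set I₁ := ∫ y in Ioi 0, CBIParams.thirdDiff y ∂p.n₁
  set I₂ := ∫ y in Ioi 0, CBIParams.thirdDiff y ∂p.n₂
  set G := ∫ x : ℝ≥0, (x : ℝ) * Real.exp (-5 * x) ∂ν
  have hsum : I₁ * G + I₂ * laplace ν 5 = 0 := by
    rw [← h1, ← h2]
    linear_combination h41 - 3 * h32
  have hA := mul_nonneg hn1 hG.le
  have hB := mul_nonneg hn2 hH.le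
  have hI1 : I₁ = 0 :=
    (mul_eq_zero.1 (show I₁ * G = 0 by linarith)).resolve_right hG.ne'
  have hI2 : I₂ = 0 :=
    (mul_eq_zero.1 (show I₂ * laplace ν 5 = 0 by linarith)).resolve_right hH.ne'
  exact ⟨Measure.eq_zero_of_setIntegral_eq_zero p.n₁_Iic (fun y => CBIParams.thirdDiff_pos) i1 hI1,
    Measure.eq_zero_of_setIntegral_eq_zero p.n₂_Iic (fun y => CBIParams.thirdDiff_pos) i2 hI2⟩

/-! ### The gamma distribution -/

theorem theorem2p3 (p : CBIParams)
    (hR : ∃ l : ℝ, 0 ≤ l ∧ p.R l ≠ 0)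
    (hF : ∃ l : ℝ, 0 ≤ l ∧ p.F l ≠ 0)
    (P : ℝ≥0 → Kernel ℝ≥0 ℝ≥0) (hP : IsCBITransitionFunction p P)
    (ν : Measure ℝ≥0) (hν : IsReversibleDistribution P ν)
    (hnd : ∀ x : ℝ≥0, ν ≠ Measure.dirac x) :
    p.n₁ = 0 ∧ p.n₂ = 0 ∧ 0 < p.a ∧ 0 < p.b ∧ 0 < p.δ ∧
      ν.map (fun x : ℝ≥0 => (x : ℝ)) = gammaMeasure (p.δ / p.a) (p.b / p.a) := by
  have := hν.prob
  obtain ⟨hn1, hn2⟩ := hν.jump_measures_eq_zero hP (hnd 0)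
  have hRl : ∀ l, p.R l = -p.a * l ^ 2 - p.b * l := fun l => by simp [CBIParams.R, hn1]
  have hFl : ∀ l, p.F l = p.δ * l := fun l => by simp [CBIParams.F, hn2]
  have hδ : 0 < p.δ := p.δ_nonneg.lt_of_ne' fun h => by
    obtain ⟨l, -, hl⟩ := hF
    exact hl (by rw [hFl, h, zero_mul])
  -- With `l = 2 s / 3` and `m = s / 3` the symmetry relation is a differential equation at `s`.
  have hode : ∀ s, 0 < s → (p.a * s + p.b) * ∫ x : ℝ≥0, (x : ℝ) * Real.exp (-s * x) ∂ν
      = p.δ * laplace ν s := fun s hs => by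
    have h := hν.R_sub_mul_eq hP (l := 2 * s / 3) (m := s / 3) (by positivity) (by positivity)
    rw [show 2 * s / 3 + s / 3 = s by ring, hRl, hRl, hFl, hFl] at h
    refine mul_left_cancel₀ hs.ne' ?_
    linear_combination -3 * h
  have hpos : ∀ s, 0 < s → 0 < p.a * s + p.b := fun s hs => by
    have h1 : 0 < p.δ * laplace ν s := mul_pos hδ (laplace_pos ν hs.le)
    rw [← hode s hs] at h1
    exact pos_of_mul_pos_left h1 (integral_mul_exp_neg_mul_pos ν (hnd 0) hs).le
  have hode' : ∀ s, 0 < s → ∫ x : ℝ≥0, (x : ℝ) * Real.exp (-s * x) ∂ν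
      = p.δ / (p.a * s + p.b) * laplace ν s := fun s hs => by
    rw [div_mul_eq_mul_div, eq_div_iff (hpos s hs).ne', mul_comm, hode s hs]
  -- For `a = 0` the solution is the Laplace transform of the point mass at `δ / b`.
  have ha : 0 < p.a := p.a_nonneg.lt_of_ne' fun ha => by
    have hb : 0 < p.b := by simpa [ha] using hpos 1 one_pos
    have hδb : 0 ≤ p.δ / p.b := by positivity
    refine hnd (p.δ / p.b).toNNReal (ext_of_laplace_eq fun n => ?_)
    have h := laplace_mul_eq_of_hasDerivAt ν (g := fun s => Real.exp (p.δ / p.b * s))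
      (c := fun s => p.δ / (p.a * s + p.b)) (by fun_prop) (fun s _ => by
        have := ((hasDerivAt_id s).const_mul (p.δ / p.b)).exp
        simp only [id] at this
        exact this.congr_deriv (by rw [ha]; ring)) hode' n.cast_nonneg
    rw [mul_zero, Real.exp_zero] at h
    rw [laplace_dirac, Real.coe_toNNReal _ hδb, eq_comm, ← mul_one (Real.exp _), ← h,
      mul_comm (laplace ν n), ← mul_assoc, ← Real.exp_add]
    ring_nf
    simp
  have hsol : ∀ s, 0 ≤ s → laplace ν s * (p.a * s + p.b) ^ (p.δ / p.a) = p.b ^ (p.δ / p.a) :=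
    fun s hs => by
    have hexp : 0 < p.δ / p.a := by positivity
    have h := laplace_mul_eq_of_hasDerivAt ν (g := fun s => (p.a * s + p.b) ^ (p.δ / p.a))
      (c := fun s => p.δ / (p.a * s + p.b))
      (Continuous.continuousOn (by fun_prop (disch := exact hexp.le)))
      (fun s hs => by
        have h1 : HasDerivAt (fun s => p.a * s + p.b) (p.a * 1) s :=
          ((hasDerivAt_id s).const_mul p.a).add_const p.b
        have h2 := h1.rpow_const (p := p.δ / p.a) (Or.inl (hpos s hs).ne')
        refine h2.congr_deriv ?_
        rw [Real.rpow_sub_one (hpos s hs).ne']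
        field_simp) hode' hs
    simpa using h
  -- For `b = 0` the solution would vanish, as the right-hand side is a positive power of `0`.
  have hb : 0 < p.b := p.b_nonneg.lt_of_ne' fun hb => by
    have h := hsol 1 zero_le_one
    rw [hb, Real.zero_rpow (by positivity)] at h
    refine (mul_pos (laplace_pos ν zero_le_one) (Real.rpow_pos_of_pos ?_ _)).ne' h
    simpa using ha
  refine ⟨hn1, hn2, ha, hb, hδ, map_coe_eq_gammaMeasure ν (by positivity) (by positivity)
    fun s hs => ?_⟩
  have hs' : 0 < p.a * s + p.b := by positivity
  rw [show p.b / p.a / (p.b / p.a + s) = p.b / (p.a * s + p.b) by field_simp; ring,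
    Real.div_rpow hb.le hs'.le, eq_div_iff (Real.rpow_pos_of_pos hs' _).ne', hsol s hs]
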